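/- Consider one uncooperative user and one adaptive user sharing a collision channel in slots $t=0,1,2,\dots$. Let $\lambda\in(0,1)$, and let the packet arrivals $A(t)\in\{0,1\}$ to the uncooperative user be i.i.d. Bernoulli($\lambda$). Its queue is empty before slot $0$; let $Q(t)$ be the number of packets in its queue just after the arrival $A(t)$. In each slot $t$ with $Q(t)>0$ the uncooperative user transmits one packet. That packet leaves the queue at the end of the slot if the adaptive user does not transmit in slot $t$; if the adaptive user does transmit in slot $t$, a collision occurs and the packet stays in the queue. The adaptive user (which always has a packet, possibly a dummy packet, to send) follows the policy $\pi^{lb}$ with parameter $p\in[0,1]$: in slot $t$ it does not transmit if a collision occurred in slot $t-1$, and otherwise it transmits with probability $p$, by randomization that is independent across slots and independent of the arrivals; no collision precedes slot $0$. Let $$p^*=\begin{cases}1,&\lambda\le\tfrac13,\\[2pt]\dfrac{1-\lambda}{2\lambda},&\lambda>\tfrac13.\end{cases}$$ Then, under $\pi^{lb}$ with $p=p^*$, the expectation $E[Q(T)]$ is finite for every $T$, and it converges to a finite limit as $T\to\infty$: $$\lim_{T\to\infty}E[Q(T)]<\infty .$$ -/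

import Mathlib

open MeasureTheory ProbabilityTheory Filter Topology
open scoped unitInterval

namespace SpectrumSharing

/-- Actions of the adaptive user: transmit or do not transmit. -/
inductive Action where
  | TR
  | NT
  deriving DecidableEq

/-- Ternary channel feedback: success, collision, idle. -/
inductive Feedback where
  | S
  | C
  | I
  deriving DecidableEq

/-- The feedback of a slot in which the uncooperative user has `q` packets in queue (it transmits
iff `0 < q`) and the adaptive user takes action `u`. -/
def feedback (q : ℕ) (u : Action) : Feedback :=
  match u with
  | .TR => if q = 0 then .S else .C
  | .NT => if q = 0 then .I else .S

/-- The number of packets that leave the uncooperative user's queue in a slot: its head-of-line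
packet departs iff the uncooperative user transmits and the adaptive user does not. -/
def departures (q : ℕ) (u : Action) : ℕ :=
  if 0 < q ∧ u = .NT then 1 else 0

/-- The policy `π^lb`: no transmission if the previous slot's feedback was a collision; otherwise
transmit iff the current coin flip is heads. The previous feedback is `none` in slot `0`. -/
def lbAction (prev : Option Feedback) (coin : Bool) : Action :=
  if prev = some .C then .NT else if coin then .TR else .NT

/-- The pair `(Q(t), u(t))` under `π^lb`, along an arrival sequence `a` and a sequence `c` of coin
flips, starting from an empty queue before the arrival of slot `0`. Here `Q(t)` counts the
packets in queue after the arrival of slot `t` and before the departure of slot `t`. -/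
def run (a : ℕ → ℕ) (c : ℕ → Bool) : ℕ → ℕ × Action
  | 0 => (a 0, lbAction none (c 0))
  | t + 1 =>
    let q := (run a c t).1
    let u := (run a c t).2
    (q - departures q u + a (t + 1), lbAction (some (feedback q u)) (c (t + 1)))

/-- The queue backlog `Q(t)` of the uncooperative user under `π^lb`. -/
def backlog (a : ℕ → ℕ) (c : ℕ → Bool) (t : ℕ) : ℕ := (run a c t).1

/-- The transmission probability `p*`, as a function of the arrival rate `lam`. -/
noncomputable def pStar (lam : I) : I :=
  ⟨if (lam : ℝ) ≤ 1 / 3 then 1 else (1 - lam) / (2 * lam), by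
    have h1 := lam.2.2
    split_ifs with h
    · simp
    · push Not at h
      constructor
      · apply div_nonneg <;> linarith
      · rw [div_le_one (by linarith)]; linarith⟩

end SpectrumSharing

/-! The queue and the collision memory of the policy combine into a single workload, driven
monotonically by i.i.d. noise. Dropping the first slot of the noise does not change its law, so
expectations of increasing functions of the workload increase in time. The square of the expected
time `m` to clear the workload has drift at most `C - 2 * (1 - ρ) * m`, where the load `ρ` is
`1 + p` times the arrival rate. Since the expectation of `m ^ 2` is increasing, that of `m` is at
most `C / (2 * (1 - ρ))` whenever `ρ < 1`. So the expected backlog is increasing and bounded, and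
it converges. For `p = p*` the load is `2 * λ` if `λ ≤ 1 / 3` and `(1 + λ) / 2` otherwise. -/

namespace SpectrumSharing

open unitInterval (toNNReal)
open scoped ENNReal NNReal

section Independence

variable {Ω ι α β : Type*} {mΩ : MeasurableSpace Ω} {P : Measure Ω} [MeasurableSpace α]
  [MeasurableSpace β] {X : ι → Ω → α} {Y : ι → Ω → β}

theorem measure_biInter_inter_preimage_eq_prod (hX_indep : iIndepFun X P)
    (hY_indep : iIndepFun Y P) (hXY : IndepFun (fun ω i => X i ω) (fun ω i => Y i ω) P)
    (J : Finset ι) {s : ι → Set α} {t : ι → Set β} (hs : ∀ i ∈ J, MeasurableSet (s i))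
    (ht : ∀ i ∈ J, MeasurableSet (t i)) :
    P (⋂ i ∈ J, X i ⁻¹' s i ∩ Y i ⁻¹' t i) = ∏ i ∈ J, P (X i ⁻¹' s i ∩ Y i ⁻¹' t i) :=
  calc P (⋂ i ∈ J, X i ⁻¹' s i ∩ Y i ⁻¹' t i)
      = P ((fun ω i => X i ω) ⁻¹' (J : Set ι).pi s ∩ (fun ω i => Y i ω) ⁻¹' (J : Set ι).pi t) := by
        congr 1
        ext ω
        simp [forall_and]
    _ = P (⋂ i ∈ J, X i ⁻¹' s i) * P (⋂ i ∈ J, Y i ⁻¹' t i) := by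
        rw [hXY.measure_inter_preimage_eq_mul _ _ (.pi J.countable_toSet hs)
          (.pi J.countable_toSet ht)]
        simp only [Set.pi_def, Set.preimage_iInter₂]
        rfl
    _ = ∏ i ∈ J, P (X i ⁻¹' s i) * P (Y i ⁻¹' t i) := by
        rw [hX_indep.measure_inter_preimage_eq_mul J hs,
          hY_indep.measure_inter_preimage_eq_mul J ht, Finset.prod_mul_distrib]
    _ = ∏ i ∈ J, P (X i ⁻¹' s i ∩ Y i ⁻¹' t i) :=
        Finset.prod_congr rfl fun i hi => ((hXY.comp (measurable_pi_apply i)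
          (measurable_pi_apply i)).measure_inter_preimage_eq_mul _ _ (hs i hi) (ht i hi)).symm

theorem iIndepFun_prodMk (hX : ∀ i, Measurable (X i)) (hY : ∀ i, Measurable (Y i))
    (hX_indep : iIndepFun X P) (hY_indep : iIndepFun Y P)
    (hXY : IndepFun (fun ω i => X i ω) (fun ω i => Y i ω) P) :
    iIndepFun (fun i ω => (X i ω, Y i ω)) P := by
  let rectangles := Set.image2 (fun (s : Set α) (t : Set β) => s ×ˢ t)
    {s | MeasurableSet s} {t | MeasurableSet t}
  rw [iIndepFun_iff_iIndep]
  refine iIndepSets.iIndep (fun i => ((hX i).prodMk (hY i)).comap_le)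
    (fun i => Set.preimage (fun ω => (X i ω, Y i ω)) '' rectangles)
    (fun i => isPiSystem_prod.comap _) (fun i => ?_) ?_
  · rw [← generateFrom_prod, MeasurableSpace.comap_generateFrom]
  · rw [iIndepSets_iff]
    intro J B hB
    choose! R hR hRB using hB
    choose! s hs t ht hst using hR
    have hB_eq (i) (hi : i ∈ J) : B i = X i ⁻¹' s i ∩ Y i ⁻¹' t i := by
      rw [← hRB i hi, ← hst i hi]
      rfl
    rw [Set.iInter₂_congr hB_eq, Finset.prod_congr rfl fun i hi => congrArg P (hB_eq i hi)]
    exact measure_biInter_inter_preimage_eq_prod hX_indep hY_indep hXY J hs ht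

theorem iIndepFun_prodMk₀ [Countable ι] (hX : ∀ i, AEMeasurable (X i) P)
    (hY : ∀ i, AEMeasurable (Y i) P) (hX_indep : iIndepFun X P) (hY_indep : iIndepFun Y P)
    (hXY : IndepFun (fun ω i => X i ω) (fun ω i => Y i ω) P) :
    iIndepFun (fun i ω => (X i ω, Y i ω)) P := by
  have hX_ae i := (hX i).ae_eq_mk
  have hY_ae i := (hY i).ae_eq_mk
  refine (iIndepFun_prodMk (fun i => (hX i).measurable_mk) (fun i => (hY i).measurable_mk)
    (hX_indep.congr hX_ae) (hY_indep.congr hY_ae) (hXY.congr ?_ ?_)).congr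
    fun i => ((hX_ae i).prodMk (hY_ae i)).symm
  · filter_upwards [ae_all_iff.2 hX_ae] with ω h using funext h
  · filter_upwards [ae_all_iff.2 hY_ae] with ω h using funext h

end Independence

section Recursion

variable {S E : Type*}

/-- The path of the stochastic recursion `X (t + 1) = f (X t) (ξ t)` started at `X 0 = x`. -/
def recursion (f : S → E → S) (x : S) (ξ : ℕ → E) : ℕ → S
  | 0 => x
  | t + 1 => f (recursion f x ξ t) (ξ t)

variable {f : S → E → S} {x : S}

theorem recursion_shift_le [Preorder S] (hf : ∀ e, Monotone fun y => f y e) (hx : ∀ e, x ≤ f x e)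
    (ξ : ℕ → E) (t : ℕ) : recursion f x (fun i => ξ (i + 1)) t ≤ recursion f x ξ (t + 1) := by
  induction t with
  | zero => exact hx (ξ 0)
  | succ t ih => exact hf (ξ (t + 1)) ih

variable [MeasurableSpace S] [MeasurableSpace E]

theorem exists_measurable_recursion_eq (hf : Measurable (Function.uncurry f)) (t : ℕ) :
    ∃ φ : (Finset.range t → E) → S, Measurable φ ∧ ∀ ξ, recursion f x ξ t = φ fun i => ξ i := by
  induction t with
  | zero => exact ⟨fun _ => x, measurable_const, fun _ => rfl⟩
  | succ t ih =>
    obtain ⟨φ, hφ, h⟩ := ih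
    refine ⟨fun y => f (φ fun i => y ⟨i, Finset.mem_range.2
      ((Finset.mem_range.1 i.2).trans t.lt_succ_self)⟩) (y ⟨t, Finset.self_mem_range_succ t⟩),
      ?_, fun ξ => by rw [recursion, h]⟩
    exact hf.comp (.prodMk (hφ.comp (by fun_prop)) (by fun_prop))

theorem measurable_recursion (hf : Measurable (Function.uncurry f)) (t : ℕ) :
    Measurable fun ξ => recursion f x ξ t := by
  induction t with
  | zero => exact measurable_const
  | succ t ih => exact hf.comp (ih.prodMk (measurable_pi_apply t))

variable {Ω : Type*} {mΩ : MeasurableSpace Ω} {P : Measure Ω} {ν : Measure E} {ξ : ℕ → Ω → E}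

theorem aemeasurable_recursion (hf : Measurable (Function.uncurry f))
    (hξ : ∀ t, AEMeasurable (ξ t) P) (t : ℕ) :
    AEMeasurable (fun ω => recursion f x (fun i => ξ i ω) t) P :=
  (measurable_recursion hf t).comp_aemeasurable (aemeasurable_pi_lambda _ hξ)

theorem identDistrib_shift (hξ : ∀ t, HasLaw (ξ t) ν P) (hξ_indep : iIndepFun ξ P) :
    IdentDistrib (fun ω t => ξ (t + 1) ω) (fun ω t => ξ t ω) P P :=
  .pi (fun t => ⟨(hξ (t + 1)).aemeasurable, (hξ t).aemeasurable,
    (hξ (t + 1)).map_eq.trans (hξ t).map_eq.symm⟩)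
    (hξ_indep.precomp (add_left_injective 1)) hξ_indep

theorem indepFun_recursion (hf : Measurable (Function.uncurry f))
    (hξ : ∀ t, AEMeasurable (ξ t) P) (hξ_indep : iIndepFun ξ P) (t : ℕ) :
    IndepFun (fun ω => recursion f x (fun i => ξ i ω) t) (ξ t) P := by
  obtain ⟨φ, hφ, h⟩ := exists_measurable_recursion_eq (x := x) hf t
  simp only [h]
  exact (hξ_indep.indepFun_finset₀ (Finset.range t) {t} (by simp) hξ).comp hφ
    (measurable_pi_apply ⟨t, Finset.mem_singleton_self t⟩)

/-- The noise from time `1` on has the same law as the whole noise, and the path it drives from `x`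
stays below the original path delayed by one. -/
theorem monotone_lintegral_recursion [Preorder S] (hf : Measurable (Function.uncurry f))
    (hf_mono : ∀ e, Monotone fun y => f y e) (hx : ∀ e, x ≤ f x e)
    (hξ : ∀ t, HasLaw (ξ t) ν P) (hξ_indep : iIndepFun ξ P) {g : S → ℝ≥0∞} (hg : Measurable g)
    (hg_mono : Monotone g) :
    Monotone fun t => ∫⁻ ω, g (recursion f x (fun i => ξ i ω) t) ∂P := by
  refine monotone_nat_of_le_succ fun t => ?_
  calc ∫⁻ ω, g (recursion f x (fun i => ξ i ω) t) ∂P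
      = ∫⁻ ω, g (recursion f x (fun i => ξ (i + 1) ω) t) ∂P :=
        ((identDistrib_shift hξ hξ_indep).comp
          (hg.comp (measurable_recursion (x := x) hf t))).lintegral_eq.symm
    _ ≤ ∫⁻ ω, g (recursion f x (fun i => ξ i ω) (t + 1)) ∂P :=
        lintegral_mono fun ω => hg_mono (recursion_shift_le hf_mono hx (fun i => ξ i ω) t)

theorem lintegral_recursion_succ [IsProbabilityMeasure P] (hf : Measurable (Function.uncurry f))
    (hξ : ∀ t, HasLaw (ξ t) ν P) (hξ_indep : iIndepFun ξ P) {g : S → ℝ≥0∞} (hg : Measurable g)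
    (t : ℕ) :
    ∫⁻ ω, g (recursion f x (fun i => ξ i ω) (t + 1)) ∂P =
      ∫⁻ ω, ∫⁻ e, g (f (recursion f x (fun i => ξ i ω) t) e) ∂ν ∂P := by
  have hX := aemeasurable_recursion (x := x) hf (fun i => (hξ i).aemeasurable) t
  have : IsProbabilityMeasure ν := (hξ 0).isProbabilityMeasure_iff.1 inferInstance
  have hlaw := (indepFun_recursion hf (fun i => (hξ i).aemeasurable) hξ_indep t).hasLaw_prod
    (⟨hX, rfl⟩ : HasLaw (fun ω => recursion f x (fun i => ξ i ω) t) _ P) (hξ t)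
  have hgf : Measurable fun z : S × E => g (f z.1 z.2) := hg.comp hf
  calc ∫⁻ ω, g (recursion f x (fun i => ξ i ω) (t + 1)) ∂P
      = ∫⁻ z, g (f z.1 z.2) ∂((P.map fun ω => recursion f x (fun i => ξ i ω) t).prod ν) :=
        hlaw.lintegral_comp hgf.aemeasurable
    _ = ∫⁻ y, ∫⁻ e, g (f y e) ∂ν ∂(P.map fun ω => recursion f x (fun i => ξ i ω) t) :=
        lintegral_prod _ hgf.aemeasurable
    _ = ∫⁻ ω, ∫⁻ e, g (f (recursion f x (fun i => ξ i ω) t) e) ∂ν ∂P :=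
        lintegral_map' hgf.lintegral_prod_right'.aemeasurable hX

theorem lintegral_recursion_le_of_drift [IsProbabilityMeasure P] [Preorder S]
    (hf : Measurable (Function.uncurry f)) (hf_mono : ∀ e, Monotone fun y => f y e)
    (hx : ∀ e, x ≤ f x e) (hξ : ∀ t, HasLaw (ξ t) ν P) (hξ_indep : iIndepFun ξ P)
    {U V : S → ℝ≥0∞} (hU : Measurable U) (hU_mono : Monotone U) (hUx : U x ≠ ∞)
    (hV : Measurable V) {C : ℝ≥0∞} (hC : C ≠ ∞)
    (hdrift : ∀ y, ∫⁻ e, U (f y e) ∂ν + V y ≤ U y + C) (t : ℕ) :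
    ∫⁻ ω, V (recursion f x (fun i => ξ i ω) t) ∂P ≤ C := by
  have hVX (t : ℕ) : AEMeasurable (fun ω => V (recursion f x (fun i => ξ i ω) t)) P :=
    hV.comp_aemeasurable (aemeasurable_recursion hf (fun i => (hξ i).aemeasurable) t)
  have hstep (t : ℕ) : ∫⁻ ω, U (recursion f x (fun i => ξ i ω) (t + 1)) ∂P +
      ∫⁻ ω, V (recursion f x (fun i => ξ i ω) t) ∂P ≤
        ∫⁻ ω, U (recursion f x (fun i => ξ i ω) t) ∂P + C := by
    calc _ = ∫⁻ ω, (∫⁻ e, U (f (recursion f x (fun i => ξ i ω) t) e) ∂ν +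
            V (recursion f x (fun i => ξ i ω) t)) ∂P := by
          rw [lintegral_recursion_succ hf hξ hξ_indep hU, lintegral_add_right' _ (hVX t)]
      _ ≤ ∫⁻ ω, (U (recursion f x (fun i => ξ i ω) t) + C) ∂P :=
          lintegral_mono fun ω => hdrift _
      _ = _ := by
          rw [lintegral_add_right _ measurable_const, lintegral_const, measure_univ, mul_one]
  have hfinite : ∫⁻ ω, U (recursion f x (fun i => ξ i ω) t) ∂P ≠ ∞ := by
    induction t with
    | zero => simpa [recursion] using hUx
    | succ t ih =>
      exact ne_top_of_le_ne_top (ENNReal.add_ne_top.2 ⟨ih, hC⟩) (le_self_add.trans (hstep t))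
  have hmono := monotone_lintegral_recursion hf hf_mono hx hξ hξ_indep hU hU_mono
  exact (ENNReal.add_le_add_iff_left hfinite).1
    ((add_le_add_left (hmono t.le_succ) _).trans (hstep t))

end Recursion

section Workload

/-- One slot of service. The workload `w` of a slot encodes the queue length `q` together with the
collision memory of the policy: `w = 2 * q` if the previous slot was not a collision, and
`w = 2 * q - 1` if it was. A collision thus removes one unit of workload, a departure removes
what is left of the packet. -/
def serve (w : ℕ) (heads : Bool) : ℕ :=
  if heads then w - 1 else 2 * ((w - 1) / 2)

/-- The workload dynamics of one slot with arrivals and coin flip `e`: each arriving packet brings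
two units of workload, then the slot is served. -/
def step (w : ℕ) (e : ℕ × Bool) : ℕ := serve (w + 2 * e.1) e.2

/-- The number of packets in queue at workload `w`; rounding up accounts for both parities of the
encoding. -/
def queueLength (w : ℕ) : ℕ := (w + 1) / 2

/-- The action of `π^lb` in terms of the workload, which is odd exactly after a collision. -/
def workloadAction (w : ℕ) (heads : Bool) : Action :=
  if Odd w then .NT else if heads then .TR else .NT

theorem monotone_serve (c : Bool) : Monotone fun w => serve w c := by
  intro v w h
  cases c <;> simp only [serve, Bool.false_eq_true, if_true, if_false] <;> omega

theorem monotone_step (e : ℕ × Bool) : Monotone fun w => step w e := fun _ _ h =>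
  monotone_serve e.2 (Nat.add_le_add_right h _)

theorem sub_departures_workloadAction (w : ℕ) (c : Bool) :
    queueLength w - departures (queueLength w) (workloadAction w c) = queueLength (serve w c) := by
  rcases Nat.even_or_odd w with hw | hw <;>
    cases c <;> simp only [queueLength, departures, workloadAction, serve] <;> grind

theorem feedback_workloadAction_eq_C_iff (w : ℕ) (c : Bool) :
    feedback (queueLength w) (workloadAction w c) = .C ↔ Odd (serve w c) := by
  rcases Nat.even_or_odd w with hw | hw <;>
    cases c <;> simp only [queueLength, feedback, workloadAction, serve] <;> grind

theorem queueLength_add_two_mul (w a : ℕ) : queueLength (w + 2 * a) = queueLength w + a := by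
  simp only [queueLength]
  omega

theorem monotone_queueLength : Monotone queueLength := fun _ _ h => by
  simp only [queueLength]
  omega

theorem run_eq (a : ℕ → ℕ) (c : ℕ → Bool) (t : ℕ) :
    run a c t =
      (queueLength (recursion step 0 (fun i => (a i, c i)) t + 2 * a t),
        workloadAction (recursion step 0 (fun i => (a i, c i)) t + 2 * a t) (c t)) := by
  induction t with
  | zero =>
    have hqueue : queueLength (2 * a 0) = a 0 := by
      simp only [queueLength]
      omega
    simp [run, recursion, hqueue, workloadAction, lbAction]
  | succ t ih =>
    have hrec : recursion step 0 (fun i => (a i, c i)) (t + 1) =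
        serve (recursion step 0 (fun i => (a i, c i)) t + 2 * a t) (c t) := rfl
    rw [run, ih, hrec]
    simp only [sub_departures_workloadAction, lbAction, Option.some.injEq,
      feedback_workloadAction_eq_C_iff]
    simp only [queueLength_add_two_mul, workloadAction, Nat.odd_add, even_two_mul, iff_true]

theorem backlog_eq (a : ℕ → ℕ) (c : ℕ → Bool) (t : ℕ) :
    backlog a c t = queueLength (recursion step 0 (fun i => (a i, c i)) t) + a t := by
  rw [backlog, run_eq, queueLength_add_two_mul]

end Workload

section Drift

/-- The expected number of slots without arrivals needed to clear the workload `w`, the Lyapunov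
function of the drift argument: a packet facing no collision memory takes a second slot with
probability `p`, a packet that has just collided takes exactly one slot. -/
noncomputable def meanClearTime (p : ℝ≥0) (w : ℕ) : ℝ≥0 := (1 + p) * (w / 2 : ℕ) + (w % 2 : ℕ)

theorem meanClearTime_add_two_mul (p : ℝ≥0) (w a : ℕ) :
    meanClearTime p (w + 2 * a) = meanClearTime p w + (1 + p) * a := by
  simp only [meanClearTime, Nat.add_mul_div_left w a two_pos, Nat.add_mul_mod_self_left,
    Nat.cast_add]
  ring

theorem meanClearTime_two_mul (p : ℝ≥0) (k : ℕ) : meanClearTime p (2 * k) = (1 + p) * k := by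
  simp [meanClearTime]

theorem meanClearTime_two_mul_add_one (p : ℝ≥0) (k : ℕ) :
    meanClearTime p (2 * k + 1) = (1 + p) * k + 1 := by
  simp [meanClearTime, Nat.mul_add_div]

theorem monotone_meanClearTime (p : ℝ≥0) : Monotone (meanClearTime p) := by
  refine monotone_nat_of_le_succ fun w => ?_
  obtain ⟨k, rfl | rfl⟩ := Nat.even_or_odd' w
  · rw [meanClearTime_two_mul_add_one, meanClearTime_two_mul]
    exact le_self_add
  · rw [meanClearTime_two_mul_add_one, show 2 * k + 1 + 1 = 2 * (k + 1) by ring,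
      meanClearTime_two_mul, Nat.cast_succ, mul_add_one]
    gcongr
    exact le_self_add

theorem queueLength_le_meanClearTime (p : ℝ≥0) (w : ℕ) : queueLength w ≤ meanClearTime p w := by
  have hsplit : queueLength w = w / 2 + w % 2 := by
    simp only [queueLength]
    omega
  rw [hsplit, meanClearTime, Nat.cast_add]
  gcongr
  exact le_mul_of_one_le_left' le_self_add

theorem meanClearTime_sq_drift {p q : ℝ≥0} (hpq : p + q = 1) (w : ℕ) :
    p * meanClearTime p (serve w true) ^ 2 + q * meanClearTime p (serve w false) ^ 2 +
      2 * meanClearTime p w ≤ meanClearTime p w ^ 2 + 2 := by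
  have hp : p ≤ 1 := hpq ▸ le_self_add
  have hodd (k : ℕ) (c : Bool) : serve (2 * k + 1) c = 2 * k := by cases c <;> simp [serve]
  have htrue (k : ℕ) : serve (2 * (k + 1)) true = 2 * k + 1 := rfl
  have hfalse (k : ℕ) : serve (2 * (k + 1)) false = 2 * k := by simp only [serve]; grind
  obtain ⟨k, rfl | rfl⟩ := Nat.even_or_odd' w
  · cases k with
    | zero => simp [serve, meanClearTime]
    | succ k =>
      rw [htrue, hfalse, meanClearTime_two_mul_add_one, meanClearTime_two_mul,
        meanClearTime_two_mul, Nat.cast_succ, mul_add_one]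
      set y := (1 + p) * (k : ℝ≥0)
      calc p * (y + 1) ^ 2 + q * y ^ 2 + 2 * (y + (1 + p))
          = (p + q) * y ^ 2 + 2 * (1 + p) * y + 2 * p + 2 + p := by ring
        _ ≤ 1 * y ^ 2 + 2 * (1 + p) * y + 2 * p + 2 + (1 + p ^ 2) := by
          rw [hpq]
          gcongr
          exact hp.trans le_self_add
        _ = (y + (1 + p)) ^ 2 + 2 := by ring
  · rw [hodd, hodd, meanClearTime_two_mul, meanClearTime_two_mul_add_one, ← add_mul, hpq]
    set y := (1 + p) * (k : ℝ≥0)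
    calc 1 * y ^ 2 + 2 * (y + 1) ≤ 1 * y ^ 2 + 2 * (y + 1) + 1 := le_self_add
      _ = (y + 1) ^ 2 + 2 := by ring

theorem lintegral_bernoulliMeasure {α : Type*} [MeasurableSpace α] (x y : α) (p : I)
    {g : α → ℝ≥0∞} (hg : Measurable g) :
    ∫⁻ a, g a ∂(bernoulliMeasure x y p) = toNNReal p * g x + toNNReal (σ p) * g y := by
  rw [bernoulliMeasure_def, lintegral_add_measure, lintegral_smul_measure, lintegral_smul_measure,
    lintegral_dirac' _ hg, lintegral_dirac' _ hg]
  rfl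

theorem lintegral_bernoulliMeasure_ne_top {α : Type*} [MeasurableSpace α] {x y : α} (p : I)
    {g : α → ℝ≥0∞} (hg : Measurable g) (hx : g x ≠ ∞) (hy : g y ≠ ∞) :
    ∫⁻ a, g a ∂(bernoulliMeasure x y p) ≠ ∞ := by
  rw [lintegral_bernoulliMeasure x y p hg]
  finiteness

/-- The traffic intensity: the expected number of slots needed to serve the arrivals of one slot
with law `μ`, as a packet takes a second slot with probability `p`. -/
noncomputable def load (p : I) (μ : Measure ℕ) : ℝ≥0∞ :=
  (1 + toNNReal p) * ∫⁻ a, (a : ℝ≥0∞) ∂μ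

variable {p : I} {μ : Measure ℕ}

theorem lintegral_meanClearTime_step_sq_add_le [SFinite μ] (w : ℕ) :
    ∫⁻ e, (meanClearTime (toNNReal p) (step w e) : ℝ≥0∞) ^ 2
        ∂(μ.prod (bernoulliMeasure true false p)) +
      ∫⁻ a, 2 * (meanClearTime (toNNReal p) (w + 2 * a) : ℝ≥0∞) ∂μ ≤
      ∫⁻ a, ((meanClearTime (toNNReal p) (w + 2 * a) : ℝ≥0∞) ^ 2 + 2) ∂μ := by
  rw [lintegral_prod _ (by fun_prop), ← lintegral_add_left (by fun_prop)]
  refine lintegral_mono fun a => ?_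
  simp only [step]
  rw [lintegral_bernoulliMeasure _ _ _ (by fun_prop)]
  exact_mod_cast meanClearTime_sq_drift (unitInterval.toNNReal_add_toNNReal_symm p) (w + 2 * a)

theorem lintegral_meanClearTime_sq_drift [IsProbabilityMeasure μ] (hload : load p μ ≤ 1) (w : ℕ) :
    ∫⁻ e, (meanClearTime (toNNReal p) (step w e) : ℝ≥0∞) ^ 2
        ∂(μ.prod (bernoulliMeasure true false p)) +
      2 * (1 - load p μ) * meanClearTime (toNNReal p) w ≤
      (meanClearTime (toNNReal p) w : ℝ≥0∞) ^ 2 +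
        ((1 + toNNReal p) ^ 2 * ∫⁻ a, (a : ℝ≥0∞) ^ 2 ∂μ + 2) := by
  set m := (meanClearTime (toNNReal p) w : ℝ≥0∞)
  set next := ∫⁻ e, (meanClearTime (toNNReal p) (step w e) : ℝ≥0∞) ^ 2
    ∂(μ.prod (bernoulliMeasure true false p))
  have hsplit : 2 * m = 2 * (1 - load p μ) * m + 2 * load p μ * m := by
    rw [← add_mul, ← mul_add, tsub_add_cancel_of_le hload, mul_one]
  have hfinite : 2 * load p μ * m ≠ ∞ := by
    have := ne_top_of_le_ne_top ENNReal.one_ne_top hload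
    finiteness
  have hcast (a : ℕ) : (meanClearTime (toNNReal p) (w + 2 * a) : ℝ≥0∞) =
      m + (1 + toNNReal p) * a := by
    rw [meanClearTime_add_two_mul]
    norm_cast
  refine (ENNReal.add_le_add_iff_right hfinite).1 ?_
  calc next + 2 * (1 - load p μ) * m + 2 * load p μ * m
      = next + 2 * m := by rw [add_assoc, ← hsplit]
    _ ≤ next + ∫⁻ a, 2 * (meanClearTime (toNNReal p) (w + 2 * a) : ℝ≥0∞) ∂μ := by
      rw [lintegral_const_mul _ (by fun_prop)]
      gcongr
      calc m = ∫⁻ _, m ∂μ := by simp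
        _ ≤ _ := lintegral_mono fun a => (hcast a).symm ▸ le_self_add
    _ ≤ ∫⁻ a, ((meanClearTime (toNNReal p) (w + 2 * a) : ℝ≥0∞) ^ 2 + 2) ∂μ :=
      lintegral_meanClearTime_step_sq_add_le w
    _ = ∫⁻ a, (m ^ 2 + 2 * m * (1 + toNNReal p) * a + (1 + toNNReal p) ^ 2 * (a : ℝ≥0∞) ^ 2 + 2)
        ∂μ := lintegral_congr fun a => by rw [hcast]; ring
    _ = m ^ 2 + ((1 + toNNReal p) ^ 2 * ∫⁻ a, (a : ℝ≥0∞) ^ 2 ∂μ + 2) + 2 * load p μ * m := by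
      rw [lintegral_add_right _ (by fun_prop), lintegral_add_right _ (by fun_prop),
        lintegral_add_right _ (by fun_prop), lintegral_const_mul _ (by fun_prop),
        lintegral_const_mul _ (by fun_prop), lintegral_const, lintegral_const, measure_univ, load]
      ring

theorem lintegral_le_load (p : I) (μ : Measure ℕ) : ∫⁻ a, (a : ℝ≥0∞) ∂μ ≤ load p μ :=
  le_mul_of_one_le_left' le_self_add

theorem load_pStar_lt_one {lam : I} (hlam : lam < 1) :
    load (pStar lam) (bernoulliMeasure 1 0 lam) < 1 := by
  have hload : (1 + (pStar lam : ℝ)) * lam < 1 := by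
    have hlam' : (lam : ℝ) < 1 := hlam
    simp only [pStar]
    split_ifs with h
    · linarith
    · have hpos : (0 : ℝ) < lam := by linarith
      calc (1 + (1 - (lam : ℝ)) / (2 * lam)) * lam = (1 + lam) / 2 := by field_simp; ring
        _ < 1 := by linarith
  rw [load, lintegral_bernoulliMeasure _ _ _ (by fun_prop), Nat.cast_one, Nat.cast_zero, mul_one,
    mul_zero, add_zero]
  norm_cast

end Drift

section Convergence

variable {Ω ι : Type*} [MeasurableSpace Ω] {P : Measure Ω} [Preorder ι]

theorem integrable_and_exists_tendsto_integral_of_monotone_lintegral {F : ι → Ω → ℝ≥0∞}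
    (hF : ∀ t, AEMeasurable (F t) P) (hmono : Monotone fun t => ∫⁻ ω, F t ω ∂P) {C : ℝ≥0∞}
    (hC : C ≠ ∞) (hle : ∀ t, ∫⁻ ω, F t ω ∂P ≤ C) :
    (∀ t, Integrable (fun ω => (F t ω).toReal) P) ∧
      ∃ L : ℝ, Tendsto (fun t => ∫ ω, (F t ω).toReal ∂P) atTop (𝓝 L) := by
  have hfinite (t : ι) : ∫⁻ ω, F t ω ∂P ≠ ∞ := ne_top_of_le_ne_top hC (hle t)
  have hintegral (t : ι) : ∫ ω, (F t ω).toReal ∂P = (∫⁻ ω, F t ω ∂P).toReal :=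
    integral_toReal (hF t) (ae_lt_top' (hF t) (hfinite t))
  simp only [hintegral]
  exact ⟨fun t => integrable_toReal_of_lintegral_ne_top (hF t) (hfinite t), _,
    (ENNReal.tendsto_toReal (ne_top_of_le_ne_top hC (iSup_le hle))).comp
      (tendsto_atTop_iSup hmono)⟩

end Convergence

section Stability

variable {Ω : Type*} [MeasurableSpace Ω] {P : Measure Ω} {p : I} {μ : Measure ℕ}
  {ξ : ℕ → Ω → ℕ × Bool}

theorem monotone_lintegral_queueLength
    (hξ : ∀ t, HasLaw (ξ t) (μ.prod (bernoulliMeasure true false p)) P) (hξ_indep : iIndepFun ξ P) :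
    Monotone fun t => ∫⁻ ω, (queueLength (recursion step 0 (fun i => ξ i ω) t) : ℝ≥0∞) ∂P :=
  monotone_lintegral_recursion (g := fun w => (queueLength w : ℝ≥0∞)) .of_discrete monotone_step
    (fun _ => Nat.zero_le _) hξ hξ_indep .of_discrete (Nat.mono_cast.comp monotone_queueLength)

theorem lintegral_queueLength_le [IsProbabilityMeasure P] [IsProbabilityMeasure μ]
    (hμ : ∫⁻ a, (a : ℝ≥0∞) ^ 2 ∂μ ≠ ∞) (hload : load p μ < 1)
    (hξ : ∀ t, HasLaw (ξ t) (μ.prod (bernoulliMeasure true false p)) P) (hξ_indep : iIndepFun ξ P)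
    (t : ℕ) :
    ∫⁻ ω, (queueLength (recursion step 0 (fun i => ξ i ω) t) : ℝ≥0∞) ∂P ≤
      ((1 + toNNReal p) ^ 2 * ∫⁻ a, (a : ℝ≥0∞) ^ 2 ∂μ + 2) / (2 * (1 - load p μ)) := by
  have hδ : 1 - load p μ ≠ 0 := (tsub_pos_of_lt hload).ne'
  have hmean := lintegral_recursion_le_of_drift
    (U := fun w => (meanClearTime (toNNReal p) w : ℝ≥0∞) ^ 2)
    (V := fun w => 2 * (1 - load p μ) * meanClearTime (toNNReal p) w)
    .of_discrete monotone_step (fun _ => Nat.zero_le _) hξ hξ_indep .of_discrete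
    (fun v w h => by dsimp only; gcongr; exact monotone_meanClearTime _ h) (by finiteness)
    .of_discrete (by finiteness) (lintegral_meanClearTime_sq_drift hload.le) t
  rw [ENNReal.le_div_iff_mul_le (by simp [hδ]) (by left; finiteness), mul_comm,
    ← lintegral_const_mul' _ _ (by finiteness)]
  refine (lintegral_mono fun ω => ?_).trans hmean
  dsimp only
  gcongr
  exact_mod_cast queueLength_le_meanClearTime _ _

theorem aemeasurable_backlog {A : ℕ → Ω → ℕ} {coin : ℕ → Ω → Bool}
    (hA : ∀ t, AEMeasurable (A t) P) (hcoin : ∀ t, AEMeasurable (coin t) P) (t : ℕ) :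
    AEMeasurable (fun ω => backlog (fun i => A i ω) (fun i => coin i ω) t) P := by
  have hX := aemeasurable_recursion (f := step) (x := 0) .of_discrete
    (fun i => (hA i).prodMk (hcoin i)) t
  simp only [backlog_eq]
  exact (Measurable.of_discrete (f := fun z : ℕ × ℕ => queueLength z.1 + z.2)).comp_aemeasurable
    (hX.prodMk (hA t))

theorem lintegral_backlog_eq {A : ℕ → Ω → ℕ} (hA : ∀ t, HasLaw (A t) μ P) (coin : ℕ → Ω → Bool)
    (t : ℕ) :
    ∫⁻ ω, (backlog (fun i => A i ω) (fun i => coin i ω) t : ℝ≥0∞) ∂P =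
      ∫⁻ ω, (queueLength (recursion step 0 (fun i => (A i ω, coin i ω)) t) : ℝ≥0∞) ∂P +
        ∫⁻ a, (a : ℝ≥0∞) ∂μ := by
  have hA_meas : AEMeasurable (fun ω => (A t ω : ℝ≥0∞)) P :=
    Measurable.of_discrete.comp_aemeasurable (hA t).aemeasurable
  simp only [backlog_eq, Nat.cast_add]
  rw [lintegral_add_right' _ hA_meas, (hA t).lintegral_comp (f := (↑)) .of_discrete]

end Stability

end SpectrumSharing

open SpectrumSharing in
open scoped ENNReal in
theorem corollary1_general {Ω : Type*} [MeasurableSpace Ω] (P : Measure Ω) [IsProbabilityMeasure P]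
    (p : I) (μ : Measure ℕ) (hμ : ∫⁻ a, (a : ℝ≥0∞) ^ 2 ∂μ ≠ ∞) (hload : load p μ < 1)
    (A : ℕ → Ω → ℕ) (hA : ∀ t, HasLaw (A t) μ P) (hA_indep : iIndepFun A P)
    (coin : ℕ → Ω → Bool) (hcoin : ∀ t, HasLaw (coin t) (bernoulliMeasure true false p) P)
    (hcoin_indep : iIndepFun coin P)
    (hA_coin : IndepFun (fun ω t => A t ω) (fun ω t => coin t ω) P) :
    (∀ T, Integrable
      (fun ω => (backlog (fun t => A t ω) (fun t => coin t ω) T : ℝ)) P) ∧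
    ∃ L : ℝ, Tendsto
      (fun T => ∫ ω, (backlog (fun t => A t ω) (fun t => coin t ω) T : ℝ) ∂P)
      atTop (𝓝 L) := by
  have : IsProbabilityMeasure μ := (hA 0).isProbabilityMeasure_iff.1 inferInstance
  have hξ (t : ℕ) :
      HasLaw (fun ω => (A t ω, coin t ω)) (μ.prod (bernoulliMeasure true false p)) P :=
    (hA_coin.comp (measurable_pi_apply t) (measurable_pi_apply t)).hasLaw_prod (hA t) (hcoin t)
  have hξ_indep := iIndepFun_prodMk₀ (fun t => (hA t).aemeasurable)
    (fun t => (hcoin t).aemeasurable) hA_indep hcoin_indep hA_coin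
  have hmono : Monotone fun t =>
      ∫⁻ ω, (backlog (fun i => A i ω) (fun i => coin i ω) t : ℝ≥0∞) ∂P := by
    simp only [lintegral_backlog_eq hA]
    exact (monotone_lintegral_queueLength hξ hξ_indep).add_const _
  have hle (t : ℕ) := (lintegral_backlog_eq hA coin t).trans_le
    (add_le_add (lintegral_queueLength_le hμ hload hξ hξ_indep t) (lintegral_le_load p μ))
  have hδ : 1 - load p μ ≠ 0 := (tsub_pos_of_lt hload).ne'
  have hmeas (t : ℕ) := (Measurable.of_discrete (f := ((↑) : ℕ → ℝ≥0∞))).comp_aemeasurable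
    (aemeasurable_backlog (fun i => (hA i).aemeasurable) (fun i => (hcoin i).aemeasurable) t)
  simpa using integrable_and_exists_tendsto_integral_of_monotone_lintegral hmeas hmono
    (by finiteness) hle

theorem corollary1 {Ω : Type*} [MeasurableSpace Ω] (P : Measure Ω) [IsProbabilityMeasure P]
    (lam : I) (hlam0 : 0 < lam) (hlam1 : lam < 1)
    -- i.i.d. Bernoulli(`lam`) arrivals to the uncooperative user
    (A : ℕ → Ω → ℕ) (hA : ∀ t, HasLaw (A t) (bernoulliMeasure 1 0 lam) P)
    (hA_indep : iIndepFun A P)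
    -- i.i.d. coin flips of the policy, with probability of heads `p*`, independent of the arrivals
    (coin : ℕ → Ω → Bool)
    (hcoin : ∀ t, HasLaw (coin t) (bernoulliMeasure true false (SpectrumSharing.pStar lam)) P)
    (hcoin_indep : iIndepFun coin P)
    (hA_coin : IndepFun (fun ω t => A t ω) (fun ω t => coin t ω) P) :
    (∀ T, Integrable
      (fun ω => (SpectrumSharing.backlog (fun t => A t ω) (fun t => coin t ω) T : ℝ)) P) ∧
    ∃ L : ℝ, Tendsto
      (fun T => ∫ ω, (SpectrumSharing.backlog (fun t => A t ω) (fun t => coin t ω) T : ℝ) ∂P)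
      atTop (𝓝 L) :=
  corollary1_general P (SpectrumSharing.pStar lam) (bernoulliMeasure 1 0 lam)
    (SpectrumSharing.lintegral_bernoulliMeasure_ne_top lam .of_discrete (by simp) (by simp))
    (SpectrumSharing.load_pStar_lt_one hlam1) A hA hA_indep coin hcoin hcoin_indep hA_coin
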